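/- Let $\epsilon\in\mathbb C\setminus\{0\}$, $q=e^{\epsilon}$, and let $\Lambda_q$ be the shift $(\Lambda_q g)(x)=g(qx)$. Difference operators $\sum_k A_k\Lambda_q^k$ are multiplied by $(a\Lambda_q^i)(b\Lambda_q^j)=a\,\Lambda_q^i(b)\,\Lambda_q^{i+j}$; put $(\sum_k A_k\Lambda_q^k)_+=\sum_{k\ge 0}A_k\Lambda_q^k$ and $\operatorname{Res}\sum_k A_k\Lambda_q^k=A_0$. The flows $\partial/\partial t_j$, $j\ge 0$, of the $q$-Toda hierarchy (QTH) on the pair $(u,v)$ are defined by the Lax equations $$\epsilon\,\frac{\partial L}{\partial t_j}=[(B_j)_+,L],\qquad L=\Lambda_q+u+e^{v}\Lambda_q^{-1},\qquad B_j=\frac{L^{j+1}}{(j+1)!}.$$ Let $\mathcal A$ be the algebra of complex polynomials in $u(q^kx),v(q^kx),e^{v(q^kx)}$, $k\in\mathbb Z$. A local functional $\int f$ is the class of $f\in\mathcal A$ modulo the total differences $\Lambda_q g-g$, $g\in\mathcal A$; its variational derivatives are $\frac{\delta}{\delta w}\int f=\sum_k\Lambda_q^{-k}\frac{\partial f}{\partial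 w(q^kx)}$, $w=u,v$. A matrix of operators $P^{ww'}$, written $\{w(x),w'(y)\}=P^{ww'}\delta(x-y)$, defines $$\{w,G\}=\sum_{w'}P^{ww'}\frac{\delta G}{\delta w'},\qquad \{F,G\}=\int\sum_{w,w'}\frac{\delta F}{\delta w}\,P^{ww'}\frac{\delta G}{\delta w'},$$ and $\{\cdot,G\}$ denotes also the derivation of $\mathcal A$ that commutes with $\Lambda_q$, obeys the chain rule on $e^v$, and sends $w$ to $\{w,G\}$. Consider the two brackets $$\{u(x),u(y)\}_1=\{v(x),v(y)\}_1=0,\qquad \{u(x),v(y)\}_1=\tfrac1\epsilon(\Lambda_q-1)\delta(x-y),$$ $$\{u(x),u(y)\}_2=\tfrac1\epsilon\big(\Lambda_q e^{v(x)}-e^{v(x)}\Lambda_q^{-1}\big)\delta(x-y),\quad \{u(x),v(y)\}_2=\tfrac1\epsilon u(x)(\Lambda_q-1)\delta(x-y),\quad \{v(x),v(y)\}_2=\tfrac1\epsilon(\Lambda_q-\Lambda_q^{-1})\delta(x-y),$$ where $P^{vu}$ is minus the formal adjoint of $P^{uv}$ (with $(a\Lambda_q^k)^*=\Lambda_q^{-k}a$),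 that is $P_1^{vu}=\frac1\epsilon(1-\Lambda_q^{-1})$ and $P_2^{vu}=\frac1\epsilon(1-\Lambda_q^{-1})u$. Let $$H_j=\int h_j,\qquad h_j=\frac{1}{(j+1)!}\operatorname{Res}L^{j+1},\qquad j\ge 0.$$ **Theorem.** 1. $\{\cdot,\cdot\}_1$ and $\{\cdot,\cdot\}_2$ are compatible Poisson brackets: they and all their linear combinations are skew-symmetric and satisfy the Jacobi identity on local functionals. 2. The flows of the QTH are Hamiltonian with respect to the first bracket: for all $j\ge 0$, $$\frac{\partial u}{\partial t_j}=\{u,H_{j+1}\}_1,\qquad \frac{\partial v}{\partial t_j}=\{v,H_{j+1}\}_1,$$ while $H_0$ is a Casimir, $\{\cdot,H_0\}_1=0$. Precisely, a derivation of $\mathcal A$ that commutes with $\Lambda_q$ and obeys the chain rule on $e^v$ satisfies the $j$-th Lax equation if and only if it equals $\{\cdot,H_{j+1}\}_1$; along it every local functional evolves by $\partial F/\partial t_j=\{F,H_{j+1}\}_1$; and functions $u(t_j,x)$, $v(t_j,x)$ solve the $j$-th Lax equation if and only if they solve this Hamiltonian system. 3. The bi-Hamiltonian recursion $\{\cdot,H_{n-1}\}_2=n\,\{\cdot,H_n\}_1$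 holds for all $n\ge 1$, both for the derivations of $\mathcal A$ and for the brackets with local functionals. -/

import Mathlib

/-! ## Difference operators

If the group `ℤ` (written multiplicatively) acts on a commutative ring `R` by ring automorphisms,
with the generator acting as `Λ`, then `SkewMonoidAlgebra R (Multiplicative ℤ)` is the ring of
difference operators `∑ A_k Λ^k` with the product
`(a Λ^i) * (b Λ^j) = a Λ^i(b) Λ^(i+j)`; the monomial `a Λ^k` is
`SkewMonoidAlgebra.single (Multiplicative.ofAdd k) a`. -/

/-- Difference operators `∑ A_k Λ^k` (finite sums) with coefficients in `R`. -/
abbrev DiffOp (R : Type*) [CommRing R] [MulSemiringAction (Multiplicative ℤ) R] : Type _ :=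
  SkewMonoidAlgebra R (Multiplicative ℤ)

noncomputable section

namespace DiffOp

variable {R : Type*} [CommRing R] [MulSemiringAction (Multiplicative ℤ) R]

/-- The monomial `a Λ^k`. -/
def mono (k : ℤ) (a : R) : DiffOp R :=
  SkewMonoidAlgebra.single (Multiplicative.ofAdd k) a

/-- The part `A_+ = ∑_{k ≥ 0} A_k Λ^k` of `A = ∑ A_k Λ^k`. -/
def plus (A : DiffOp R) : DiffOp R :=
  ⟨A.coeff.filter (fun k => 0 ≤ Multiplicative.toAdd k)⟩

/-- The residue `Res A = A_0` of `A = ∑ A_k Λ^k`. -/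
def res (A : DiffOp R) : R := A.coeff (Multiplicative.ofAdd 0)

/-- The operator `L = Λ + a + b Λ^(-1)`. -/
def lax (a b : R) : DiffOp R := mono 1 1 + mono 0 a + mono (-1) b

/-- `B_j = L^(j+1) / (j+1)!` for `L = Λ + a + b Λ^(-1)`. -/
def B [Algebra ℂ R] (a b : R) (j : ℕ) : DiffOp R :=
  (((j + 1).factorial : ℂ)⁻¹) • lax a b ^ (j + 1)

end DiffOp

/-! ## Difference polynomials in `u`, `v`, `e^v` -/

namespace QToda

/-- The two fields. -/
inductive Fld : Type
  | u : Fld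
  | v : Fld

/-- The generators `u(q^k x)`, `v(q^k x)` and `e^{v(q^k x)}`, `k ∈ ℤ`. -/
inductive Jet : Type
  | u : ℤ → Jet
  | v : ℤ → Jet
  | expv : ℤ → Jet

/-- The shift `x ↦ q^n x` on generators. -/
def Jet.shift (n : ℤ) : Jet → Jet
  | .u k => .u (k + n)
  | .v k => .v (k + n)
  | .expv k => .expv (k + n)

/-- Densities: polynomials with complex coefficients in the functions
`u(q^k x)`, `v(q^k x)`, `e^{v(q^k x)}`, `k ∈ ℤ`. -/
abbrev Density : Type := MvPolynomial Jet ℂ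

/-- The field `u(q^k x)`. -/
def uu (k : ℤ) : Density := MvPolynomial.X (Jet.u k)

/-- The field `v(q^k x)`. -/
def vv (k : ℤ) : Density := MvPolynomial.X (Jet.v k)

/-- The exponential `e^{v(q^k x)}`. -/
def ev (k : ℤ) : Density := MvPolynomial.X (Jet.expv k)

/-- `Λ_q^n`, the substitution `x ↦ q^n x`. -/
def shift (n : ℤ) : Density →ₐ[ℂ] Density := MvPolynomial.rename (Jet.shift n)

theorem shift_zero (f : Density) : shift 0 f = f := by
  have h : Jet.shift 0 = id := by
    funext j; cases j <;> simp [Jet.shift]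
  simp [shift, h]

theorem shift_shift (m n : ℤ) (f : Density) : shift m (shift n f) = shift (m + n) f := by
  have h : Jet.shift m ∘ Jet.shift n = Jet.shift (m + n) := by
    funext j; cases j <;> simp [Jet.shift, add_comm m n, add_assoc]
  simp [shift, MvPolynomial.rename_rename, h]

instance : MulSemiringAction (Multiplicative ℤ) Density where
  smul n f := shift (Multiplicative.toAdd n) f
  one_smul f := shift_zero f
  mul_smul m n f := (shift_shift (Multiplicative.toAdd m) (Multiplicative.toAdd n) f).symm
  smul_zero _ := map_zero _
  smul_add _ _ _ := map_add _ _ _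
  smul_one _ := map_one _
  smul_mul _ _ _ := map_mul _ _ _

/-! ### Local functionals and variational derivatives -/

/-- The total differences `Λ_q g - g`. -/
def totalDifferences : Submodule ℂ Density :=
  LinearMap.range ((shift 1).toLinearMap - LinearMap.id)

/-- Local functionals `∫ f`: densities modulo total differences. -/
abbrev Functional : Type := Density ⧸ totalDifferences

/-- The functional `∫ f` of a density `f`. -/
def integral : Density →ₗ[ℂ] Functional := totalDifferences.mkQ

/-- The partial derivatives of a density with respect to `w(q^k x)`, `k ∈ ℤ`, for `w = u` or
`w = v`, collected in the finitely supported family `k ↦ ∂f/∂w(q^k x)`. The generator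
`e^{v(q^k x)}` is differentiated by the chain rule. -/
def grad : Fld → Derivation ℂ Density (ℤ →₀ Density)
  | .u => MvPolynomial.mkDerivation ℂ fun
      | .u k => Finsupp.single k 1
      | .v _ => 0
      | .expv _ => 0
  | .v => MvPolynomial.mkDerivation ℂ fun
      | .u _ => 0
      | .v k => Finsupp.single k 1
      | .expv k => Finsupp.single k (ev k)

/-- The map `(a_k)_k ↦ ∑_k Λ_q^{-k} a_k`. -/
def pullBack : (ℤ →₀ Density) →ₗ[ℂ] Density :=
  Finsupp.lsum ℂ fun k => (shift (-k)).toLinearMap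

/-- The variational derivative `∑_k Λ_q^{-k} (∂f/∂w(q^k x))` of a density. -/
def varDerivDensity (w : Fld) : Density →ₗ[ℂ] Density :=
  pullBack ∘ₗ (grad w).toLinearMap

/-- The map `(a_k)_k ↦ (Λ_q a_{k-1})_k`. -/
def push : (ℤ →₀ Density) →ₗ[ℂ] (ℤ →₀ Density) :=
  Finsupp.lsum ℂ fun k => Finsupp.lsingle (k + 1) ∘ₗ (shift 1).toLinearMap

theorem push_smul (a : Density) (m : ℤ →₀ Density) : push (a • m) = shift 1 a • push m := by
  induction m using Finsupp.induction_linear with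
  | zero => simp
  | add f g hf hg => simp [smul_add, hf, hg]
  | single k b => rw [Finsupp.smul_single]; simp only [push, Finsupp.lsum_single,
      LinearMap.comp_apply, AlgHom.toLinearMap_apply, Finsupp.lsingle_apply, smul_eq_mul, map_mul,
      Finsupp.smul_single]

theorem grad_shift (w : Fld) (f : Density) : grad w (shift 1 f) = push (grad w f) := by
  induction f using MvPolynomial.induction_on with
  | C a =>
    have h : shift 1 (MvPolynomial.C a) = MvPolynomial.C a := by simp [shift]
    have h' : grad w (MvPolynomial.C a) = 0 := (grad w).map_algebraMap a
    rw [h, h', map_zero]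
  | add f g hf hg => simp [hf, hg]
  | mul_X f i hf =>
    have hX : grad w (shift 1 (MvPolynomial.X i)) = push (grad w (MvPolynomial.X i)) := by
      cases w <;> cases i <;>
        simp [shift, Jet.shift, grad, push, ev, MvPolynomial.mkDerivation_X]
    rw [map_mul, Derivation.leibniz, Derivation.leibniz, map_add, push_smul, push_smul, hf, hX]

theorem pullBack_push (m : ℤ →₀ Density) : pullBack (push m) = pullBack m := by
  induction m using Finsupp.induction_linear with
  | zero => simp
  | add f g hf hg => simp [hf, hg]
  | single k b =>
    simp [push, pullBack, shift_shift]

theorem varDerivDensity_totalDifference (w : Fld) :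
    totalDifferences ≤ LinearMap.ker (varDerivDensity w) := by
  rintro _ ⟨f, rfl⟩
  simp [varDerivDensity, grad_shift, pullBack_push]

/-- The variational derivative `δF/δw` of a local functional. -/
def varDeriv (w : Fld) : Functional →ₗ[ℂ] Density :=
  totalDifferences.liftQ (varDerivDensity w) (varDerivDensity_totalDifference w)

/-! ### Brackets -/

/-- A matrix of linear operators `P^{w w'}` on densities. It stands for the bracket
`{w(x), w'(y)} = P^{w w'} δ(x - y)`. -/
abbrev OpMatrix : Type := Fld → Fld → (Density →ₗ[ℂ] Density)

/-- Multiplication by a density. -/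
def mulOp (a : Density) : Density →ₗ[ℂ] Density := LinearMap.mulLeft ℂ a

/-- `Λ_q^n` as a linear operator. -/
def Lam (n : ℤ) : Density →ₗ[ℂ] Density := (shift n).toLinearMap

/-- The first bracket:
`{u(x), u(y)} = {v(x), v(y)} = 0`, `{u(x), v(y)} = ε⁻¹ (Λ_q - 1) δ(x - y)`.
The entry `vu` is minus the formal adjoint of the entry `uv`. -/
def P₁ (ε : ℂ) : OpMatrix
  | .u, .u => 0
  | .u, .v => ε⁻¹ • (Lam 1 - LinearMap.id)
  | .v, .u => ε⁻¹ • (LinearMap.id - Lam (-1))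
  | .v, .v => 0

/-- The second bracket:
`{u(x), u(y)} = ε⁻¹ (Λ_q e^v - e^v Λ_q^{-1}) δ(x - y)`,
`{u(x), v(y)} = ε⁻¹ u (Λ_q - 1) δ(x - y)`,
`{v(x), v(y)} = ε⁻¹ (Λ_q - Λ_q^{-1}) δ(x - y)`.
The entry `vu` is minus the formal adjoint of the entry `uv`. -/
def P₂ (ε : ℂ) : OpMatrix
  | .u, .u => ε⁻¹ • (Lam 1 ∘ₗ mulOp (ev 0) - mulOp (ev 0) ∘ₗ Lam (-1))
  | .u, .v => ε⁻¹ • (mulOp (uu 0) ∘ₗ (Lam 1 - LinearMap.id))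
  | .v, .u => ε⁻¹ • ((LinearMap.id - Lam (-1)) ∘ₗ mulOp (uu 0))
  | .v, .v => ε⁻¹ • (Lam 1 - Lam (-1))

/-- `{w, G} = ∑_{w'} P^{w w'} (δG/δw')` for a field `w` and a functional `G`. -/
def fieldBracket (P : OpMatrix) (w : Fld) : Functional →ₗ[ℂ] Density :=
  P w .u ∘ₗ varDeriv .u + P w .v ∘ₗ varDeriv .v

/-- The derivation `{·, G}` of densities: the Hamiltonian vector field of `G`, which
commutes with `Λ_q` and sends `w` to `{w, G}` for `w = u, v`. -/
def hamField (P : OpMatrix) (G : Functional) : Derivation ℂ Density Density :=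
  MvPolynomial.mkDerivation ℂ fun
    | .u k => shift k (fieldBracket P .u G)
    | .v k => shift k (fieldBracket P .v G)
    | .expv k => ev k * shift k (fieldBracket P .v G)

/-- The bracket `{F, G} = ∫ ∑_{w,w'} (δF/δw) P^{w w'} (δG/δw')` of local functionals. -/
def bracket (P : OpMatrix) : Functional →ₗ[ℂ] Functional →ₗ[ℂ] Functional :=
  LinearMap.mk₂ ℂ
    (fun F G => integral
      (varDeriv .u F * fieldBracket P .u G + varDeriv .v F * fieldBracket P .v G))
    (fun F F' G => by rw [← map_add]; congr 1; simp only [map_add]; ring)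
    (fun c F G => by rw [← map_smul]; congr 1; simp)
    (fun F G G' => by rw [← map_add]; congr 1; simp only [map_add]; ring)
    (fun c F G => by rw [← map_smul]; congr 1; simp)

/-- A bilinear bracket on local functionals is Poisson if it is skew-symmetric and satisfies the
Jacobi identity. -/
structure IsPoisson (b : Functional →ₗ[ℂ] Functional →ₗ[ℂ] Functional) : Prop where
  skew : ∀ F G, b F G = -b G F
  jacobi : ∀ F G H, b F (b G H) + b G (b H F) + b H (b F G) = 0

/-- Two brackets are compatible if all their linear combinations are Poisson. -/
def Compatible (b b' : Functional →ₗ[ℂ] Functional →ₗ[ℂ] Functional) : Prop :=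
  ∀ c c' : ℂ, IsPoisson (c • b + c' • b')

/-! ### Hamiltonians and flows -/

/-- The density `h_j = Res L^{j+1} / (j+1)!`, `L = Λ_q + u + e^v Λ_q^{-1}`. -/
def h (j : ℕ) : Density := DiffOp.res (DiffOp.B (uu 0) (ev 0) j)

/-- The Hamiltonian `H_j = ∫ h_j`. -/
def H (j : ℕ) : Functional := integral (h j)

/-- The `t_j`-flow of the hierarchy as an evolutionary vector field: a derivation `D = ∂/∂t_j` of
the densities that commutes with `Λ_q`, obeys the chain rule `D e^v = e^v D v` and satisfies the Lax
equation `ε D L = [(B_j)_+, L]` for `L = Λ_q + u + e^v Λ_q^{-1}`, where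
`D L = D u + (D e^v) Λ_q^{-1}`. -/
structure IsFlow (ε : ℂ) (j : ℕ) (D : Derivation ℂ Density Density) : Prop where
  comm_shift : ∀ f, D (shift 1 f) = shift 1 (D f)
  chain_rule : D (ev 0) = ev 0 * D (vv 0)
  lax_eq : ε • (DiffOp.mono 0 (D (uu 0)) + DiffOp.mono (-1) (D (ev 0)) : DiffOp Density) =
    ⁅DiffOp.plus (DiffOp.B (uu 0) (ev 0) j), DiffOp.lax (uu 0) (ev 0)⁆

/-! ### Solutions of the hierarchy by functions of `x` and `t_j` -/

/-- Functions of `x`, on which `Λ_q`, `q = e^ε`, acts by `(Λ_q g)(x) = g(q x)`. -/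
def QFun (_ε : ℂ) : Type := ℂ → ℂ

instance (ε : ℂ) : CommRing (QFun ε) := inferInstanceAs (CommRing (ℂ → ℂ))

instance (ε : ℂ) : Algebra ℂ (QFun ε) := inferInstanceAs (Algebra ℂ (ℂ → ℂ))

instance (ε : ℂ) : MulSemiringAction (Multiplicative ℤ) (QFun ε) where
  smul n g := fun x => g (Complex.exp ε ^ Multiplicative.toAdd n * x)
  one_smul g := funext fun x => by
    change g (Complex.exp ε ^ (0 : ℤ) * x) = g x
    simp
  mul_smul m n g := funext fun x => by
    change g (Complex.exp ε ^ (Multiplicative.toAdd m + Multiplicative.toAdd n) * x) =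
      g (Complex.exp ε ^ Multiplicative.toAdd n * (Complex.exp ε ^ Multiplicative.toAdd m * x))
    rw [zpow_add₀ (Complex.exp_ne_zero ε), ← mul_assoc, mul_comm (Complex.exp ε ^ _)]
  smul_zero _ := rfl
  smul_add _ _ _ := rfl
  smul_one _ := rfl
  smul_mul _ _ _ := rfl

/-- The functions `u(t, x)`, `v(t, x)` are differentiable in `t = t_j` at time `t` and satisfy there
the Lax equation `ε ∂L/∂t_j = [(B_j)_+, L]`, with `L = Λ_q + u + e^v Λ_q^{-1}`. -/
def SolvesLax (ε : ℂ) (j : ℕ) (U V : ℂ → ℂ → ℂ) (t : ℂ) : Prop :=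
  ∃ du dv : ℂ → ℂ,
    (∀ x, HasDerivAt (fun s => U s x) (du x) t) ∧
    (∀ x, HasDerivAt (fun s => V s x) (dv x) t) ∧
    let u : QFun ε := U t
    let w : QFun ε := fun x => Complex.exp (V t x)
    let w' : QFun ε := fun x => Complex.exp (V t x) * dv x
    let u' : QFun ε := du
    ε • (DiffOp.mono 0 u' + DiffOp.mono (-1) w') =
      ⁅DiffOp.plus (DiffOp.B u w j), DiffOp.lax u w⁆

/-- The value at `x` of a density on functions `u(x)`, `v(x)`, with `q = e^ε`. -/
def evalAt (ε : ℂ) (u v : ℂ → ℂ) (x : ℂ) : Density →ₐ[ℂ] ℂ :=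
  MvPolynomial.aeval fun
    | .u k => u (Complex.exp ε ^ k * x)
    | .v k => v (Complex.exp ε ^ k * x)
    | .expv k => Complex.exp (v (Complex.exp ε ^ k * x))

/-- The functions `u(t, x)`, `v(t, x)` satisfy at time `t` the Hamiltonian system
`∂u/∂t = {u, G}`, `∂v/∂t = {v, G}`. -/
def SolvesHamilton (ε : ℂ) (P : OpMatrix) (G : Functional) (U V : ℂ → ℂ → ℂ) (t : ℂ) : Prop :=
  ∀ x, HasDerivAt (fun s => U s x) (evalAt ε (U t) (V t) x (fieldBracket P .u G)) t ∧
    HasDerivAt (fun s => V s x) (evalAt ε (U t) (V t) x (fieldBracket P .v G)) t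

end QToda

end

/-! Poisson property. Every combination of the two brackets has the form `bracket (pencil α β)`, so
one argument with free `α`, `β` gives both Poisson brackets and their compatibility. The pencil
comes from an ordinary bracket `pb` on the polynomial ring of densities: a biderivation fixed by its
values on generators and commuting with shifts. Its Jacobiator is a derivation in each argument, so
it vanishes once it does on triples of `u`'s and `v`'s (`jac_eq_zero`). The Hamiltonian vector field
of `∫ g` is the finite sum `∑_k {·, Λ^k g}` (`hasFinsum_hamField`). Summing skew-symmetry and Jacobi
of `pb` over shifts gives the same identities for functionals (`bracket_pencil_skew`,
`hamField_hamField`).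

Flows. Leibniz and cyclicity of `∫ Res` give `δH_n/δw = Res(L^n δL/δw)/n!` up to total differences.
With `ℓ_k` the `Λ^k`-coefficient of `L^n/n!` (`lcf n k`), this reads `δH_n/δu = ℓ_0` and `δH_n/δv =
e^v Λ^{-1} ℓ_1`. As powers of `L` commute with `L`, `[(B_j)_+, L]` has only coefficients of `Λ^0`
and `Λ^{-1}`, and these are differences of `ℓ_{-1}` and `ℓ_0` for `n = j + 1` (`lie_plus_lax`). The
zeroth coefficient of `[L^n, L] = 0` states `(Λ - 1) ℓ_{-1} = (Λ - 1) δH_n/δv`, which matches the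
Lax equation with the first bracket.

Recursion. It compares coefficients of `Λ^{-1}` and `Λ^0` in `L^{m+1} = L^m L = L L^m`
(`fieldBracket_recursion`). For functions, evaluation intertwines the shifts and maps coefficients
of `L^n` to coefficients of `L^n`. -/

noncomputable section

/-! ### Coefficients of difference operators and the truncated commutator. -/

namespace DiffOp

variable {R : Type*} [CommRing R] [MulSemiringAction (Multiplicative ℤ) R]

/-- The coefficient `A_k` of `A = ∑ A_k Λ^k`. -/
def cf (A : DiffOp R) (k : ℤ) : R := A.coeff (Multiplicative.ofAdd k)

/-- The action of `Λ^n` on coefficients. -/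
def act (n : ℤ) : R →+* R := MulSemiringAction.toRingHom (Multiplicative ℤ) R (.ofAdd n)

theorem act_act (m n : ℤ) (r : R) : act m (act n r) = act (m + n) r :=
  (mul_smul (Multiplicative.ofAdd m) (Multiplicative.ofAdd n) r).symm

theorem act_zero (r : R) : act 0 r = r := one_smul (Multiplicative ℤ) r

theorem ext_cf {A A' : DiffOp R} (h : ∀ k, cf A k = cf A' k) : A = A' :=
  SkewMonoidAlgebra.ext fun k => h k.toAdd

@[simp] theorem cf_add (A A' : DiffOp R) (k : ℤ) : cf (A + A') k = cf A k + cf A' k := by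
  simp [cf]

@[simp] theorem cf_sub (A A' : DiffOp R) (k : ℤ) : cf (A - A') k = cf A k - cf A' k := by
  simp [cf]

@[simp] theorem cf_zero (k : ℤ) : cf (0 : DiffOp R) k = 0 := by
  simp [cf]

@[simp] theorem cf_smul {S : Type*} [SMulZeroClass S R] (c : S) (A : DiffOp R) (k : ℤ) :
    cf (c • A) k = c • cf A k := by
  simp [cf]

theorem cf_mono (n : ℤ) (a : R) (k : ℤ) : cf (mono n a) k = if k = n then a else 0 := by
  classical
  rw [cf, mono, SkewMonoidAlgebra.coeff_single_apply]
  simp [eq_comm]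

theorem cf_one (k : ℤ) : cf (1 : DiffOp R) k = if k = 0 then 1 else 0 :=
  cf_mono 0 1 k

theorem cf_plus (A : DiffOp R) (k : ℤ) : cf (plus A) k = if 0 ≤ k then cf A k else 0 := by
  classical
  simp [cf, plus, Finsupp.filter_apply]

theorem cf_mul_mono (A : DiffOp R) (n : ℤ) (a : R) (k : ℤ) :
    cf (A * mono n a) k = cf A (k - n) * act (k - n) a := by
  simp only [cf, mono, SkewMonoidAlgebra.coeff_mul_single]
  rfl

theorem cf_mono_mul (A : DiffOp R) (n : ℤ) (a : R) (k : ℤ) :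
    cf (mono n a * A) k = a * act n (cf A (k - n)) := by
  simp only [cf, mono, SkewMonoidAlgebra.coeff_single_mul]
  rw [show (Multiplicative.ofAdd n)⁻¹ * Multiplicative.ofAdd k = Multiplicative.ofAdd (k - n) by
    rw [mul_comm]; rfl]
  rfl

theorem mono_mul_mono (m n : ℤ) (a b : R) : mono m a * mono n b = mono (m + n) (a * act m b) :=
  SkewMonoidAlgebra.single_mul_single

theorem cf_mul_lax (A : DiffOp R) (a b : R) (k : ℤ) :
    cf (A * lax a b) k = cf A (k - 1) + cf A k * act k a + cf A (k + 1) * act (k + 1) b := by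
  simp [lax, mul_add, cf_mul_mono]

theorem cf_lax_mul (A : DiffOp R) (a b : R) (k : ℤ) :
    cf (lax a b * A) k = act 1 (cf A (k - 1)) + a * cf A k + b * act (-1) (cf A (k + 1)) := by
  simp [lax, add_mul, cf_mono_mul, act_zero]

variable {A : DiffOp R} {a b : R}

/-- The coefficients of the commutation relation with the Lax operator. -/
theorem cf_commute (h : Commute A (lax a b)) (k : ℤ) :
    cf A (k - 1) + cf A k * act k a + cf A (k + 1) * act (k + 1) b =
      act 1 (cf A (k - 1)) + a * cf A k + b * act (-1) (cf A (k + 1)) := by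
  rw [← cf_mul_lax, ← cf_lax_mul, h.eq]

/-- The `Λ^0` coefficient of `[A, L] = 0`. It trades `A_{-1}`, which occurs in the Lax equation, for
`b Λ^{-1} A_1`, which is a variational derivative when `A` is a power of `L`. -/
theorem act_sub_cf_neg_one (h : Commute A (lax a b)) :
    act 1 (cf A (-1)) - cf A (-1) =
      act 1 (b * act (-1) (cf A 1)) - b * act (-1) (cf A 1) := by
  have h0 := cf_commute h 0
  simp only [zero_sub, zero_add, act_zero] at h0
  rw [map_mul, act_act, show (1 : ℤ) + -1 = 0 by norm_num, act_zero]
  linear_combination -h0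

/-- The commutator of the nonnegative part of an operator commuting with `L = Λ + a + b Λ⁻¹`. -/
theorem lie_plus_lax (h : Commute A (lax a b)) :
    ⁅plus A, lax a b⁆ = mono 0 (act 1 (cf A (-1)) - cf A (-1)) +
      mono (-1) (b * (cf A 0 - act (-1) (cf A 0))) := by
  refine ext_cf fun k => ?_
  rw [Ring.lie_def, cf_sub, cf_mul_lax, cf_lax_mul, cf_add, cf_mono, cf_mono]
  simp only [cf_plus]
  have hk := cf_commute h k
  -- Truncation disturbs the relation `[A, L] = 0` only at `k = -1`, where `A_0` alone survives, and
  -- at `k = 0`, where the terms with `A_{-1}` are lost. Below these everything vanishes, above them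
  -- nothing changes.
  rcases lt_trichotomy k (-1) with h1 | rfl | h1
  · simp [show ¬ 0 ≤ k by omega, show ¬ 1 ≤ k by omega, show ¬ 0 ≤ k + 1 by omega,
      show k ≠ 0 by omega, show k ≠ -1 by omega]
  · simp [act_zero]; ring
  · rcases eq_or_lt_of_le (show 0 ≤ k by omega) with rfl | h2
    · simp [act_zero] at hk ⊢
      linear_combination hk
    · simp only [show 0 ≤ k by omega, show 0 ≤ k - 1 by omega, show 0 ≤ k + 1 by omega,
        show k ≠ 0 by omega, show k ≠ -1 by omega, if_true, if_false]
      linear_combination hk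

variable [Algebra ℂ R]

theorem cf_B (a b : R) (j : ℕ) (k : ℤ) :
    cf (B a b j) k = (((j + 1).factorial : ℂ)⁻¹) • cf (lax a b ^ (j + 1)) k := cf_smul _ _ _

theorem commute_B [SMulCommClass (Multiplicative ℤ) ℂ R] (a b : R) (j : ℕ) :
    Commute (B a b j) (lax a b) := by
  have h : Commute (lax a b ^ (j + 1)) (lax a b) := (Commute.refl _).pow_left _
  refine ext_cf fun k => ?_
  have hs : ∀ (n : ℤ) (c : ℂ) (r : R), act n (c • r) = c • act n r := fun n c r =>
    smul_comm (Multiplicative.ofAdd n) c r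
  have hk := cf_commute h k
  simp only [cf_mul_lax, cf_lax_mul, cf_B, hs, smul_mul_assoc, mul_smul_comm, ← smul_add, hk]

end DiffOp

end

noncomputable section

namespace QToda

open DiffOp

/-! ### Shifts of fields and of gradients. -/

theorem act_eq_shift (n : ℤ) (f : Density) : act n f = shift n f := rfl

@[simp] theorem shift_uu (n k : ℤ) : shift n (uu k) = uu (k + n) := by
  simp [shift, uu, Jet.shift]

@[simp] theorem shift_vv (n k : ℤ) : shift n (vv k) = vv (k + n) := by
  simp [shift, vv, Jet.shift]

@[simp] theorem shift_ev (n k : ℤ) : shift n (ev k) = ev (k + n) := by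
  simp [shift, ev, Jet.shift]

/-- The shift `Λ_q^n` of families `k ↦ a_k`. -/
def pushN (n : ℤ) : (ℤ →₀ Density) →ₗ[ℂ] (ℤ →₀ Density) :=
  Finsupp.lsum ℂ fun k => Finsupp.lsingle (k + n) ∘ₗ (shift n).toLinearMap

@[simp] theorem pushN_single (n k : ℤ) (b : Density) :
    pushN n (Finsupp.single k b) = Finsupp.single (k + n) (shift n b) := by
  simp [pushN]

@[simp] theorem pullBack_single (k : ℤ) (b : Density) :
    pullBack (Finsupp.single k b) = shift (-k) b := by
  simp [pullBack]

theorem pushN_apply (n : ℤ) (m : ℤ →₀ Density) (k : ℤ) :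
    pushN n m k = shift n (m (k - n)) := by
  classical
  induction m using Finsupp.induction_linear with
  | zero => simp
  | add f g hf hg => simp [hf, hg]
  | single i b =>
    rw [pushN_single, Finsupp.single_apply, Finsupp.single_apply]
    by_cases h : i + n = k
    · simp [show i = k - n by omega]
    · simp [h, show i ≠ k - n by omega]

theorem pushN_smul (n : ℤ) (a : Density) (m : ℤ →₀ Density) :
    pushN n (a • m) = shift n a • pushN n m := by
  ext1 k
  simp [pushN_apply]

theorem pullBack_pushN (n : ℤ) (m : ℤ →₀ Density) : pullBack (pushN n m) = pullBack m := by
  induction m using Finsupp.induction_linear with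
  | zero => simp
  | add f g hf hg => simp [hf, hg]
  | single k b => simp [shift_shift]

theorem grad_shiftN (w : Fld) (n : ℤ) (f : Density) :
    grad w (shift n f) = pushN n (grad w f) := by
  induction f using MvPolynomial.induction_on with
  | C a =>
    have h : shift n (MvPolynomial.C a) = MvPolynomial.C a := by simp [shift]
    have h' : grad w (MvPolynomial.C a) = 0 := (grad w).map_algebraMap a
    rw [h, h', map_zero]
  | add f g hf hg => simp [hf, hg]
  | mul_X f i hf =>
    have hX : grad w (shift n (MvPolynomial.X i)) = pushN n (grad w (MvPolynomial.X i)) := by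
      cases w <;> cases i <;>
        simp [shift, Jet.shift, grad, ev, MvPolynomial.mkDerivation_X]
    rw [map_mul, Derivation.leibniz, Derivation.leibniz, map_add, pushN_smul, pushN_smul, hf, hX]

/-! ### The variation of `∫ Res`. -/

/-- The variational form `δ/δw ∫ Res (X ∘ Y)`, with `X` kept fixed. -/
def traceVar (w : Fld) (X Y : DiffOp Density) : Density :=
  Y.coeff.sum fun k y => pullBack (shift k.toAdd (cf X (-k.toAdd)) • grad w y)

theorem traceVar_add_right (w : Fld) (X Y Y' : DiffOp Density) :
    traceVar w X (Y + Y') = traceVar w X Y + traceVar w X Y' := by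
  rw [traceVar, SkewMonoidAlgebra.coeff_add, Finsupp.sum_add_index']
  · rfl
  · simp
  · simp

theorem traceVar_zero_right (w : Fld) (X : DiffOp Density) : traceVar w X 0 = 0 := by
  simp [traceVar]

theorem traceVar_mono (w : Fld) (X : DiffOp Density) (k : ℤ) (y : Density) :
    traceVar w X (mono k y) = pullBack (shift k (cf X (-k)) • grad w y) := by
  simp [traceVar, mono]

theorem mono_induction {p : DiffOp Density → Prop} (X : DiffOp Density) (h0 : p 0)
    (hm : ∀ k x, p (mono k x)) (ha : ∀ X Y, p X → p Y → p (X + Y)) : p X :=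
  SkewMonoidAlgebra.induction_on X h0 (fun g a => hm g.toAdd a) ha

theorem traceVar_add_left (w : Fld) (X X' Y : DiffOp Density) :
    traceVar w (X + X') Y = traceVar w X Y + traceVar w X' Y := by
  induction Y using mono_induction with
  | h0 => simp [traceVar_zero_right]
  | hm k y => simp [traceVar_mono, add_smul]
  | ha Y Z hY hZ => simp only [traceVar_add_right, hY, hZ]; abel

theorem traceVar_zero_left (w : Fld) (Y : DiffOp Density) : traceVar w 0 Y = 0 := by
  simpa using traceVar_add_left w 0 0 Y

/-- Leibniz rule combined with cyclicity of `∫ Res`. Everything is additive in the three operators,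
so monomials suffice, and only those of total degree zero contribute. -/
theorem traceVar_mul (w : Fld) (X Y Z : DiffOp Density) :
    traceVar w X (Y * Z) = traceVar w (X * Y) Z + traceVar w (Z * X) Y := by
  induction X using mono_induction with
  | h0 => simp [traceVar_zero_left]
  | ha X X' h h' => simp only [add_mul, mul_add, traceVar_add_left, h, h']; abel
  | hm i x =>
  induction Y using mono_induction with
  | h0 => simp [traceVar_zero_left, traceVar_zero_right]
  | ha Y Y' h h' =>
    simp only [add_mul, mul_add, traceVar_add_left, traceVar_add_right, h, h']; abel
  | hm j y =>
  induction Z using mono_induction with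
  | h0 => simp [traceVar_zero_left, traceVar_zero_right]
  | ha Y Y' h h' =>
    simp only [add_mul, mul_add, traceVar_add_left, traceVar_add_right, h, h']; abel
  | hm k z =>
    simp only [mono_mul_mono, traceVar_mono, cf_mono]
    by_cases hk : i = -(j + k)
    · subst hk
      have hz : pullBack (shift (j + k) x • y • grad w (shift j z)) =
          pullBack (shift k (x * shift (-(j + k)) y) • grad w z) := by
        rw [← pullBack_pushN j (shift k (x * _) • _), pushN_smul, ← grad_shiftN, smul_smul]
        simp [shift_shift, shift_zero]
      have hy : shift (j + k) x * shift j z = shift j (z * shift k x) := by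
        rw [map_mul, shift_shift, mul_comm]
      simp only [show -(j + k) + j = -k by ring, show k + -(j + k) = -j by ring, if_true,
        act_eq_shift, Derivation.leibniz, smul_add, map_add, hz, smul_smul (shift (j + k) x) _
        (grad w y), hy]
    · simp [show -k + -j ≠ i by omega, show -k ≠ i + j by omega, show -j ≠ k + i by omega]

theorem traceVar_one (w : Fld) (Y : DiffOp Density) :
    traceVar w 1 Y = varDerivDensity w (cf Y 0) := by
  induction Y using mono_induction with
  | h0 => simp [traceVar_zero_right]
  | ha Y Y' h h' => simp only [traceVar_add_right, h, h', cf_add, map_add]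
  | hm k y =>
    rw [traceVar_mono, cf_one, cf_mono]
    by_cases hk : k = 0
    · subst hk
      simp [varDerivDensity]
    · simp [hk, Ne.symm hk]

/-- Peeling off one factor `L` at a time; by cyclicity each of the `k + 1` factors contributes the
same term. -/
theorem traceVar_pow (w : Fld) (L : DiffOp Density) (m k : ℕ) :
    traceVar w (L ^ m) (L ^ (k + 1)) = (k + 1 : ℂ) • traceVar w (L ^ (m + k)) L := by
  induction k generalizing m with
  | zero => simp
  | succ k ih =>
    rw [pow_succ' L (k + 1), traceVar_mul, ← pow_succ, ih, ← pow_add,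
      show m + 1 + k = m + (k + 1) by ring, show k + 1 + m = m + (k + 1) by ring]
    push_cast
    module

/-- `δ/δw ∫ Res L^(n+1) = (n+1) Res (L^n δL/δw)`. -/
theorem varDerivDensity_res_pow (w : Fld) (L : DiffOp Density) (n : ℕ) :
    varDerivDensity w (cf (L ^ (n + 1)) 0) = (n + 1 : ℂ) • traceVar w (L ^ n) L := by
  rw [← traceVar_one]
  simpa using traceVar_pow w L 0 n

/-! ### Gradients of the Hamiltonians and identities for the coefficients of `L^n`. -/

theorem traceVar_u_lax (X : DiffOp Density) :
    traceVar .u X (lax (uu 0) (ev 0)) = cf X 0 := by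
  simp [lax, traceVar_add_right, traceVar_mono, grad, uu, ev, MvPolynomial.mkDerivation_X,
    shift_zero]

/-- Here `δL/δv = e^v Λ^{-1}`, which pairs with the coefficient of `Λ`. -/
theorem traceVar_v_lax (X : DiffOp Density) :
    traceVar .v X (lax (uu 0) (ev 0)) = ev 0 * shift (-1) (cf X 1) := by
  simp [lax, traceVar_add_right, traceVar_mono, grad, uu, ev, MvPolynomial.mkDerivation_X,
    shift_zero, -Finsupp.single_mul, mul_comm (MvPolynomial.X _)]

theorem varDeriv_H (w : Fld) (n : ℕ) :
    varDeriv w (H n) = ((n.factorial : ℂ)⁻¹) •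
      traceVar w (lax (uu 0) (ev 0) ^ n) (lax (uu 0) (ev 0)) := by
  have h1 : varDeriv w (H n) = varDerivDensity w (cf (B (uu 0) (ev 0) n) 0) := rfl
  rw [h1, cf_B, map_smul, varDerivDensity_res_pow, smul_smul, Nat.factorial_succ]
  congr 1
  push_cast
  field_simp

/-- The coefficient of `Λ_q^k` in `L^n / n!`. -/
def lcf (n : ℕ) (k : ℤ) : Density := ((n.factorial : ℂ)⁻¹) • cf (lax (uu 0) (ev 0) ^ n) k

theorem varDeriv_u_H (n : ℕ) : varDeriv .u (H n) = lcf n 0 := by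
  rw [varDeriv_H, traceVar_u_lax]; rfl

theorem varDeriv_v_H (n : ℕ) : varDeriv .v (H n) = ev 0 * shift (-1) (lcf n 1) := by
  rw [varDeriv_H, traceVar_v_lax, lcf, map_smul, mul_smul_comm]

theorem shift_varDeriv_v_H (n : ℕ) :
    shift 1 (varDeriv .v (H n)) - varDeriv .v (H n) = shift 1 (lcf n (-1)) - lcf n (-1) := by
  have h : Commute (lax (uu 0) (ev 0) ^ n) (lax (uu 0) (ev 0)) := (Commute.refl _).pow_left _
  rw [varDeriv_v_H, lcf, lcf, map_smul, map_smul, mul_smul_comm, map_smul, ← smul_sub, ← smul_sub]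
  congr 1
  exact (act_sub_cf_neg_one h).symm

/-- Coefficients of `L^{n+1} = L^n L`; the factor `n + 1` absorbs the change of factorial and
becomes the factor in the bi-Hamiltonian recursion. -/
theorem succ_smul_lcf (n : ℕ) (k : ℤ) : ((n + 1 : ℕ) : ℂ) • lcf (n + 1) k =
    lcf n (k - 1) + lcf n k * uu k + lcf n (k + 1) * ev (k + 1) := by
  rw [lcf, pow_succ, cf_mul_lax, smul_smul, Nat.factorial_succ]
  simp only [lcf, smul_mul_assoc, ← smul_add, act_eq_shift, shift_uu, shift_ev, zero_add]
  congr 1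
  push_cast
  field_simp

theorem lcf_commute (n : ℕ) (k : ℤ) :
    lcf n (k - 1) + lcf n k * uu k + lcf n (k + 1) * ev (k + 1) =
      shift 1 (lcf n (k - 1)) + uu 0 * lcf n k + ev 0 * shift (-1) (lcf n (k + 1)) := by
  have h : Commute (lax (uu 0) (ev 0) ^ n) (lax (uu 0) (ev 0)) := (Commute.refl _).pow_left _
  have hk := cf_commute h k
  simp only [act_eq_shift, shift_uu, shift_ev, zero_add] at hk
  simp only [lcf, smul_mul_assoc, mul_smul_comm, map_smul, ← smul_add, hk]

end QToda

end

noncomputable section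

namespace QToda

open DiffOp

/-! ### Sums with finite support -/

/-- The family `F` has finite support and sum `s`. -/
def HasFinsum {ι M : Type*} [AddCommMonoid M] (F : ι → M) (s : M) : Prop :=
  F.support.Finite ∧ ∑ᶠ i, F i = s

namespace HasFinsum

variable {ι κ M N : Type*} [AddCommGroup M] [AddCommGroup N] {F G : ι → M} {s t : M}

theorem unique (hF : HasFinsum F s) (hG : HasFinsum F t) : s = t := hF.2.symm.trans hG.2

theorem zero : HasFinsum (fun _ : ι => (0 : M)) 0 := by
  constructor
  · simp [Function.support]
  · simp

theorem single (i : ι) (h : ∀ k, k ≠ i → F k = 0) : HasFinsum F (F i) := by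
  constructor
  · refine (Set.finite_singleton i).subset fun k hk => ?_
    by_contra hki
    exact hk (h k hki)
  · exact finsum_eq_single F i h

theorem add (hF : HasFinsum F s) (hG : HasFinsum G t) :
    HasFinsum (fun i => F i + G i) (s + t) := by
  constructor
  · exact (hF.1.union hG.1).subset (Function.support_add F G)
  · rw [finsum_add_distrib hF.1 hG.1, hF.2, hG.2]

theorem map {Φ : Type*} [FunLike Φ M N] [AddMonoidHomClass Φ M N] (φ : Φ) (hF : HasFinsum F s) :
    HasFinsum (fun i => φ (F i)) (φ s) := by
  constructor
  · exact hF.1.subset (Function.support_comp_subset (map_zero φ) F)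
  · rw [← hF.2]
    exact (AddMonoidHom.map_finsum (φ : M →+ N) hF.1).symm

theorem neg (hF : HasFinsum F s) : HasFinsum (fun i => -F i) (-s) :=
  hF.map (-AddMonoidHom.id M)

theorem sub (hF : HasFinsum F s) (hG : HasFinsum G t) :
    HasFinsum (fun i => F i - G i) (s - t) := by
  simpa only [sub_eq_add_neg] using hF.add hG.neg

theorem reindex (e : κ ≃ ι) (hF : HasFinsum F s) : HasFinsum (fun k => F (e k)) s := by
  constructor
  · exact hF.1.preimage e.injective.injOn
  · rw [← hF.2]
    exact finsum_comp_equiv e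

theorem mul_left {R : Type*} [Ring R] {F : ι → R} {s : R} (a : R) (hF : HasFinsum F s) :
    HasFinsum (fun i => a * F i) (a * s) :=
  hF.map (AddMonoidHom.mulLeft a)

/-- Fubini for finite sums. Besides summable rows it needs finitely many nonzero rows, since a
vanishing row sum does not make the row vanish. -/
theorem prod {F : ι × κ → M} {F₁ : ι → M} {T : Set ι} (hT : T.Finite)
    (h0 : ∀ i ∉ T, ∀ k, F (i, k) = 0) (h1 : ∀ i, HasFinsum (fun k => F (i, k)) (F₁ i))
    (h2 : HasFinsum F₁ s) : HasFinsum F s := by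
  have hfin : F.support.Finite := by
    have : F.support ⊆ ⋃ i ∈ T, Prod.mk i '' Function.support (fun k => F (i, k)) := by
      rintro ⟨i, k⟩ h
      have hi : i ∈ T := by
        by_contra hi
        exact h (h0 i hi k)
      exact Set.mem_biUnion hi ⟨k, h, rfl⟩
    exact (hT.biUnion fun i _ => (h1 i).1.image _).subset this
  refine ⟨hfin, ?_⟩
  rw [finsum_curry F hfin, ← h2.2]
  exact finsum_congr fun i => (h1 i).2

end HasFinsum

/-! ### The Poisson pencil -/

/-- `α + β u(q^k x)`. -/
def aff (α β : ℂ) (k : ℤ) : Density := MvPolynomial.C α + β • uu k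

/-- The combination `α {·,·}₁ + β {·,·}₂` of the two brackets, for `ε = 1`. -/
def pencil (α β : ℂ) : OpMatrix
  | .u, .u => β • (Lam 1 ∘ₗ mulOp (ev 0) - mulOp (ev 0) ∘ₗ Lam (-1))
  | .u, .v => mulOp (aff α β 0) ∘ₗ (Lam 1 - LinearMap.id)
  | .v, .u => (LinearMap.id - Lam (-1)) ∘ₗ mulOp (aff α β 0)
  | .v, .v => β • (Lam 1 - Lam (-1))

/-- `[j = i + 1] - [j = i]`. -/
def fwd (i j : ℤ) : ℂ := (if j = i + 1 then 1 else 0) - (if j = i then 1 else 0)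

/-- `[j = i + 1] - [j = i - 1]`. -/
def cen (i j : ℤ) : ℂ := (if j = i + 1 then 1 else 0) - (if j = i - 1 then 1 else 0)

/-- The coefficient of `δ` in `{u(q^i x), u(q^j x)}` for the second bracket. -/
def cenExp (i j : ℤ) : Density := (if j = i + 1 then ev j else 0) - (if j = i - 1 then ev i else 0)

/-- The Poisson brackets of the generators. -/
def jetBracket (α β : ℂ) : Jet → Jet → Density
  | .u i, .u j => β • cenExp i j
  | .u i, .v j => fwd i j • aff α β i
  | .u i, .expv j => ev j * (fwd i j • aff α β i)
  | .v i, .u j => -(fwd j i • aff α β j)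
  | .v i, .v j => MvPolynomial.C (β * cen i j)
  | .v i, .expv j => ev j * MvPolynomial.C (β * cen i j)
  | .expv i, .u j => -(ev i * (fwd j i • aff α β j))
  | .expv i, .v j => ev i * MvPolynomial.C (β * cen i j)
  | .expv i, .expv j => ev i * (ev j * MvPolynomial.C (β * cen i j))

/-- The derivation `{f, ·}` of the local Poisson bracket on densities. -/
def pb (α β : ℂ) (f : Density) : Derivation ℂ Density Density :=
  MvPolynomial.mkDerivation ℂ fun j => MvPolynomial.mkDerivation ℂ (fun i => jetBracket α β i j) f

variable {α β : ℂ}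

theorem pb_X (f : Density) (j : Jet) :
    pb α β f (MvPolynomial.X j) = MvPolynomial.mkDerivation ℂ (fun i => jetBracket α β i j) f :=
  MvPolynomial.mkDerivation_X _ _ _

theorem pb_X_X (i j : Jet) :
    pb α β (MvPolynomial.X i) (MvPolynomial.X j) = jetBracket α β i j := by
  rw [pb_X, MvPolynomial.mkDerivation_X]

theorem pb_add (f f' : Density) : pb α β (f + f') = pb α β f + pb α β f' :=
  MvPolynomial.derivation_ext fun j => by simp [pb_X]

theorem pb_mul (f f' : Density) : pb α β (f * f') = f • pb α β f' + f' • pb α β f :=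
  MvPolynomial.derivation_ext fun j => by simp [pb_X]

theorem pb_C (c : ℂ) : pb α β (MvPolynomial.C c) = 0 :=
  MvPolynomial.derivation_ext fun j => by
    rw [pb_X]
    exact Derivation.map_algebraMap _ c

theorem pb_zero : pb α β 0 = 0 := by
  simpa using pb_C (α := α) (β := β) 0

theorem cen_swap (i j : ℤ) : cen i j = -cen j i := by
  simp only [cen, show (j = i + 1) = (i = j - 1) by rw [eq_iff_iff]; omega,
    show (j = i - 1) = (i = j + 1) by rw [eq_iff_iff]; omega, neg_sub]

theorem cenExp_swap (i j : ℤ) : cenExp i j = -cenExp j i := by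
  simp only [cenExp, show (j = i + 1) = (i = j - 1) by rw [eq_iff_iff]; omega,
    show (j = i - 1) = (i = j + 1) by rw [eq_iff_iff]; omega, neg_sub]

theorem jetBracket_swap (i j : Jet) : jetBracket α β i j = -jetBracket α β j i := by
  cases i <;> cases j <;> simp only [jetBracket, neg_neg]
  · rw [cenExp_swap, smul_neg]
  · rw [cen_swap]; simp
  · rw [cen_swap]; simp
  · rw [cen_swap]; simp
  · rw [cen_swap]; simp; ring

theorem pb_swap (f g : Density) : pb α β f g = -pb α β g f := by
  have h : ∀ j, pb α β f (MvPolynomial.X j) = -pb α β (MvPolynomial.X j) f := fun j => by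
    have : MvPolynomial.mkDerivation ℂ (fun i => jetBracket α β i j) =
        -pb α β (MvPolynomial.X j) :=
      MvPolynomial.derivation_ext fun i => by
        rw [MvPolynomial.mkDerivation_X, Derivation.neg_apply, pb_X_X, jetBracket_swap]
    rw [pb_X, this, Derivation.neg_apply]
  induction g using MvPolynomial.induction_on with
  | C a =>
    rw [pb_C]
    simp
  | add g g' hg hg' => rw [map_add, pb_add, hg, hg', Derivation.add_apply, neg_add]
  | mul_X g i hg =>
    rw [Derivation.leibniz, pb_mul, hg, h]
    simp only [Derivation.add_apply, Derivation.smul_apply, smul_neg, neg_add]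

@[simp] theorem shift_C (n : ℤ) (c : ℂ) : shift n (MvPolynomial.C c) = MvPolynomial.C c := by
  simp [shift]

theorem shift_X (n : ℤ) (i : Jet) : shift n (MvPolynomial.X i) = MvPolynomial.X (i.shift n) := by
  simp [shift]

@[simp] theorem shift_aff (n k : ℤ) : shift n (aff α β k) = aff α β (k + n) := by
  simp [aff]

theorem jetBracket_shift (n : ℤ) (i j : Jet) :
    jetBracket α β (i.shift n) (j.shift n) = shift n (jetBracket α β i j) := by
  have e : ∀ i j : ℤ, (j + n = i + n + 1) = (j = i + 1) := fun i j => by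
    rw [eq_iff_iff]; omega
  have e' : ∀ i j : ℤ, (j + n = i + n - 1) = (j = i - 1) := fun i j => by
    rw [eq_iff_iff]; omega
  have e'' : ∀ i j : ℤ, (j + n = i + n) = (j = i) := fun i j => by
    rw [eq_iff_iff]; omega
  cases i <;> cases j <;>
    simp only [Jet.shift, jetBracket, cenExp, cen, fwd, e, e', e'', map_smul, map_mul, map_neg,
      map_sub, apply_ite (shift n), map_zero, shift_ev, shift_aff, shift_C]

theorem pb_shift_X (n : ℤ) (i : Jet) (g : Density) :
    pb α β (shift n (MvPolynomial.X i)) (shift n g) =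
      shift n (pb α β (MvPolynomial.X i) g) := by
  induction g using MvPolynomial.induction_on with
  | C a => simp [pb_swap _ (MvPolynomial.C a), pb_C]
  | add g g' h h' => simp [h, h']
  | mul_X g j h =>
    rw [map_mul, Derivation.leibniz, Derivation.leibniz, h]
    simp [shift_X, pb_X_X, jetBracket_shift]

theorem pb_shift (n : ℤ) (f g : Density) :
    pb α β (shift n f) (shift n g) = shift n (pb α β f g) := by
  induction f using MvPolynomial.induction_on with
  | C a => simp [pb_C]
  | add f f' h h' => simp [pb_add, h, h']
  | mul_X f i h =>
    simp [pb_mul, h, pb_shift_X]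

theorem pb_ev (i : ℤ) : pb α β (ev i) = ev i • pb α β (vv i) :=
  MvPolynomial.derivation_ext fun j => by
    rw [Derivation.smul_apply, ev, vv, pb_X_X, pb_X_X]
    cases j <;> simp [jetBracket, ev]

theorem pb_apply_ev (f : Density) (j : ℤ) : pb α β f (ev j) = ev j * pb α β f (vv j) := by
  rw [pb_swap, pb_ev, pb_swap f, Derivation.smul_apply]
  simp

/-! ### Jacobi identity -/

/-- The Jacobiator of the bracket of densities. -/
def jac (α β : ℂ) (f g h : Density) : Density :=
  pb α β f (pb α β g h) + pb α β g (pb α β h f) + pb α β h (pb α β f g)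

theorem jac_rotate (f g h : Density) : jac α β f g h = jac α β g h f := by
  simp only [jac]; ring

/-- In this form the Jacobiator is visibly a derivation in its last argument, so it can be checked
on generators. -/
theorem jac_eq_derivation (f g h : Density) :
    jac α β f g h = (⁅pb α β f, pb α β g⁆ - pb α β (pb α β f g)) h := by
  rw [jac, Derivation.sub_apply, Derivation.commutator_apply, pb_swap h f, pb_swap h (pb α β f g),
    map_neg]
  ring

theorem jac_eq_zero_of_X {f g : Density} (hX : ∀ i, jac α β f g (MvPolynomial.X i) = 0)
    (h : Density) : jac α β f g h = 0 := by
  have : ⁅pb α β f, pb α β g⁆ - pb α β (pb α β f g) = 0 :=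
    MvPolynomial.derivation_ext fun i => by
      rw [← jac_eq_derivation, hX, Derivation.zero_apply]
  rw [jac_eq_derivation, this, Derivation.zero_apply]

/-- The bracket respects the chain rule for `e^v`, so the exponential generators need no Jacobi
check of their own. -/
theorem jac_ev (f g : Density) (k : ℤ) :
    jac α β f g (ev k) = ev k * jac α β f g (vv k) := by
  simp only [jac, pb_ev, pb_apply_ev, Derivation.leibniz, Derivation.smul_apply, smul_eq_mul,
    pb_swap (vv k) f]
  ring

theorem pb_u_u (i j : ℤ) : pb α β (uu i) (uu j) = β • cenExp i j := pb_X_X _ _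
theorem pb_u_v (i j : ℤ) : pb α β (uu i) (vv j) = fwd i j • aff α β i := pb_X_X _ _
theorem pb_v_u (i j : ℤ) : pb α β (vv i) (uu j) = -(fwd j i • aff α β j) := pb_X_X _ _
theorem pb_v_v (i j : ℤ) : pb α β (vv i) (vv j) = MvPolynomial.C (β * cen i j) := pb_X_X _ _

theorem pb_apply_C (f : Density) (c : ℂ) : pb α β f (MvPolynomial.C c) = 0 :=
  (pb α β f).map_algebraMap c

theorem pb_apply_aff (f : Density) (k : ℤ) : pb α β f (aff α β k) = β • pb α β f (uu k) := by
  rw [aff, map_add, pb_apply_C, zero_add, Derivation.map_smul]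

theorem jac_v_v_v (i j k : ℤ) : jac α β (vv i) (vv j) (vv k) = 0 := by
  simp only [jac, pb_v_v, pb_apply_C, add_zero]

theorem jac_u_v_v (i j k : ℤ) : jac α β (uu i) (vv j) (vv k) = 0 := by
  simp only [jac, pb_v_v, pb_apply_C, pb_v_u, pb_u_v, map_neg, Derivation.map_smul,
    pb_apply_aff]
  module

theorem pb_v_ev (i j : ℤ) : pb α β (vv i) (ev j) = ev j * MvPolynomial.C (β * cen i j) :=
  pb_X_X _ _

theorem pb_u_ev (i j : ℤ) : pb α β (uu i) (ev j) = ev j * (fwd i j • aff α β i) := pb_X_X _ _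

/-- The two forward differences telescope to the central difference around the larger of the
neighbours `i`, `j`. Being symmetric in `i`, `j`, the formula covers both orders. -/
theorem pb_v_cenExp (k i j : ℤ) :
    pb α β (vv k) (cenExp i j) = -(β * (fwd j k + fwd i k)) • cenExp i j := by
  rcases em (j = i + 1) with rfl | h
  · simp only [cenExp, pb_v_ev, if_true, show i + 1 ≠ i - 1 by omega, if_false, sub_zero]
    rw [mul_comm, ← MvPolynomial.smul_eq_C_mul]
    congr 2
    simp only [cen, fwd]
    split_ifs <;> first | omega | simp
  rcases em (j = i - 1) with rfl | h'
  · simp only [cenExp, pb_v_ev, if_true, show i - 1 ≠ i + 1 by omega, if_false, zero_sub, map_neg,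
      smul_neg]
    rw [mul_comm, ← MvPolynomial.smul_eq_C_mul]
    congr 3
    simp only [cen, fwd]
    split_ifs <;> first | omega | simp
  · simp [cenExp, h, h']

theorem pb_u_cenExp (k i j : ℤ) : pb α β (uu k) (cenExp i j) =
    (if j = i + 1 then fwd k j else fwd k i) • (cenExp i j * aff α β k) := by
  rcases em (j = i + 1) with rfl | h
  · simp [cenExp, pb_u_ev, show i + 1 ≠ i - 1 by omega]
  rcases em (j = i - 1) with rfl | h'
  · simp [cenExp, pb_u_ev, h]
  · simp [cenExp, h, h']

theorem jac_u_u_v (i j k : ℤ) : jac α β (uu i) (uu j) (vv k) = 0 := by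
  simp only [jac, pb_u_u, pb_u_v, pb_v_u, map_neg, Derivation.map_smul, pb_apply_aff, pb_v_cenExp,
    cenExp_swap j i]
  module

/-- If two indices agree, skew-symmetry suffices. For distinct indices each term vanishes: `{u_j,
u_k}` involves only the exponential at the larger of two neighbours, and `u_i` pairs with it only if
`i` is one of them. -/
theorem jac_u_u_u (i j k : ℤ) : jac α β (uu i) (uu j) (uu k) = 0 := by
  have h0 (i : ℤ) : cenExp i i = 0 := by
    simp [cenExp, show i ≠ i - 1 by omega]
  have h1 {i j k : ℤ} (hij : i ≠ j) (hik : i ≠ k) : pb α β (uu i) (cenExp j k) = 0 := by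
    rw [pb_u_cenExp]
    split_ifs with h
    · simp [fwd, show k ≠ i + 1 by omega, hik.symm]
    · by_cases h' : k = j - 1
      · simp [fwd, show j ≠ i + 1 by omega, hij.symm]
      · simp [cenExp, h, h']
  simp only [jac, pb_u_u, Derivation.map_smul]
  rcases eq_or_ne i j with rfl | hij
  · rw [h0, cenExp_swap k i]; simp
  rcases eq_or_ne j k with rfl | hjk
  · rw [h0, cenExp_swap j i]; simp
  rcases eq_or_ne i k with rfl | hik
  · rw [h0, cenExp_swap j i]; simp
  rw [h1 hij hik, h1 hjk hij.symm, h1 hik.symm hjk.symm]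
  simp

/-- The generators `u(q^k x)` and `v(q^k x)`. -/
def fld : Fld → ℤ → Density
  | .u => uu
  | .v => vv

theorem jac_eq_zero_of_fld {f g : Density} (hX : ∀ w k, jac α β f g (fld w k) = 0)
    (h : Density) : jac α β f g h = 0 := by
  refine jac_eq_zero_of_X ?_ h
  rintro (k | k | k)
  · exact hX .u k
  · exact hX .v k
  · exact (jac_ev f g k).trans (by rw [show vv k = fld .v k from rfl, hX, mul_zero])

theorem jac_fld (w w' w'' : Fld) (i j k : ℤ) :
    jac α β (fld w i) (fld w' j) (fld w'' k) = 0 := by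
  cases w <;> cases w' <;> cases w''
  · exact jac_u_u_u i j k
  · exact jac_u_u_v i j k
  · exact (jac_rotate _ _ _).symm.trans (jac_u_u_v k i j)
  · exact jac_u_v_v i j k
  · exact (jac_rotate _ _ _).trans (jac_u_u_v j k i)
  · exact (jac_rotate _ _ _).trans (jac_u_v_v j k i)
  · exact (jac_rotate _ _ _).symm.trans (jac_u_v_v k i j)
  · exact jac_v_v_v i j k

/-- The Jacobi identity for densities. -/
theorem jac_eq_zero (f g h : Density) : jac α β f g h = 0 := by
  have h1 (w w' : Fld) (i j : ℤ) (h : Density) : jac α β (fld w i) (fld w' j) h = 0 :=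
    jac_eq_zero_of_fld (fun w'' k => jac_fld w w' w'' i j k) h
  have h2 (w : Fld) (i : ℤ) (f h : Density) : jac α β f (fld w i) h = 0 :=
    jac_eq_zero_of_fld (fun w' j => (jac_rotate _ _ _).trans (h1 w w' i j f)) h
  exact jac_eq_zero_of_fld (fun w i => (jac_rotate _ _ _).trans (h2 w i g f)) h

end QToda

end

noncomputable section

namespace QToda

open DiffOp

variable {α β : ℂ}

/-! ### Hamiltonian vector fields as sums over shifts -/

/-- The `k`-th term is `Λ^k m_{n-k} = Λ^n Λ^{-(n-k)} m_{n-k}`. This is how variational derivatives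
arise from sums of partial derivatives over shifts. -/
theorem hasFinsum_pushN (m : ℤ →₀ Density) (n : ℤ) :
    HasFinsum (fun k => pushN k m n) (shift n (pullBack m)) := by
  induction m using Finsupp.induction_linear with
  | zero => simpa using HasFinsum.zero
  | add f g hf hg => simpa using hf.add hg
  | single j b =>
    have h := HasFinsum.single (F := fun k => pushN k (Finsupp.single j b) n) (n - j)
      fun k hk => by simp [show n ≠ j + k by omega]
    simpa [shift_shift, sub_eq_add_neg] using h

theorem hasFinsum_grad (w : Fld) (g : Density) (n : ℤ) :
    HasFinsum (fun k => grad w (shift k g) n) (shift n (varDeriv w (integral g))) := by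
  simp only [grad_shiftN]
  exact hasFinsum_pushN _ _

/-- Both sides are derivations in `f` agreeing on generators. Summed over shifts of `f`, the
gradients turn into variational derivatives. -/
theorem pb_u_eq (i : ℤ) (f : Density) : pb α β (uu i) f =
    β • (ev (i + 1) * grad .u f (i + 1) - ev i * grad .u f (i - 1)) +
      aff α β i * (grad .v f (i + 1) - grad .v f i) := by
  induction f using MvPolynomial.induction_on with
  | C a => simp [show ∀ w, grad w (MvPolynomial.C a) = 0 from
      fun w => Derivation.map_algebraMap _ a]
  | add f g hf hg => simp only [map_add, Finsupp.add_apply, hf, hg, mul_add, MvPolynomial.smul_eq_C_mul]; ring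
  | mul_X f j hf =>
    have hX : pb α β (uu i) (MvPolynomial.X j) =
        β • (ev (i + 1) * grad .u (MvPolynomial.X j) (i + 1) -
          ev i * grad .u (MvPolynomial.X j) (i - 1)) +
        aff α β i * (grad .v (MvPolynomial.X j) (i + 1) - grad .v (MvPolynomial.X j) i) := by
      rw [uu, pb_X_X]
      rcases j with j | j | j <;>
        simp only [jetBracket, grad, MvPolynomial.mkDerivation_X, cenExp, fwd,
          Finsupp.single_apply, Finsupp.coe_zero, Pi.zero_apply] <;>
        split_ifs <;> (try subst j) <;> first | omega | simp [mul_comm]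
    rw [Derivation.leibniz, Derivation.leibniz, Derivation.leibniz, hf, hX]
    simp only [Finsupp.add_apply, Finsupp.smul_apply, smul_eq_mul, MvPolynomial.smul_eq_C_mul]
    ring

theorem pb_v_eq (i : ℤ) (f : Density) : pb α β (vv i) f =
    (aff α β i * grad .u f i - aff α β (i - 1) * grad .u f (i - 1)) +
      β • (grad .v f (i + 1) - grad .v f (i - 1)) := by
  induction f using MvPolynomial.induction_on with
  | C a => simp [show ∀ w, grad w (MvPolynomial.C a) = 0 from
      fun w => Derivation.map_algebraMap _ a]
  | add f g hf hg => simp only [map_add, Finsupp.add_apply, hf, hg, smul_sub, smul_add]; ring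
  | mul_X f j hf =>
    have hX : pb α β (vv i) (MvPolynomial.X j) =
        (aff α β i * grad .u (MvPolynomial.X j) i -
          aff α β (i - 1) * grad .u (MvPolynomial.X j) (i - 1)) +
        β • (grad .v (MvPolynomial.X j) (i + 1) - grad .v (MvPolynomial.X j) (i - 1)) := by
      rw [vv, pb_X_X]
      rcases j with j | j | j <;>
        simp only [jetBracket, grad, MvPolynomial.mkDerivation_X, cen, fwd,
          Finsupp.single_apply, Finsupp.coe_zero, Pi.zero_apply] <;>
        split_ifs <;> (try subst j) <;> first | omega | simp [MvPolynomial.smul_eq_C_mul, mul_comm]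
    rw [Derivation.leibniz, Derivation.leibniz, Derivation.leibniz, hf, hX]
    simp only [Finsupp.add_apply, Finsupp.smul_apply, smul_eq_mul, MvPolynomial.smul_eq_C_mul]
    ring

theorem HasFinsum.smul {ι : Type*} {F : ι → Density} {s : Density} (c : ℂ) (hF : HasFinsum F s) :
    HasFinsum (fun i => c • F i) (c • s) :=
  hF.map (DistribSMul.toAddMonoidHom Density c)

theorem hasFinsum_pb_u (i : ℤ) (g : Density) :
    HasFinsum (fun k => pb α β (uu i) (shift k g))
      (shift i (fieldBracket (pencil α β) .u (integral g))) := by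
  simp only [pb_u_eq]
  have hu := hasFinsum_grad .u g
  have hv := hasFinsum_grad .v g
  convert ((((hu (i + 1)).mul_left (ev (i + 1))).sub ((hu (i - 1)).mul_left (ev i))).smul β).add
    (((hv (i + 1)).sub (hv i)).mul_left (aff α β i)) using 1
  · rfl
  · simp [fieldBracket, pencil, Lam, mulOp, shift_shift, add_comm i, sub_eq_add_neg]

theorem hasFinsum_pb_v (i : ℤ) (g : Density) :
    HasFinsum (fun k => pb α β (vv i) (shift k g))
      (shift i (fieldBracket (pencil α β) .v (integral g))) := by
  simp only [pb_v_eq]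
  have hu := hasFinsum_grad .u g
  have hv := hasFinsum_grad .v g
  convert (((hu i).mul_left (aff α β i)).sub ((hu (i - 1)).mul_left (aff α β (i - 1)))).add
    (((hv (i + 1)).sub (hv (i - 1))).smul β) using 1
  · rfl
  · simp [fieldBracket, pencil, Lam, mulOp, shift_shift, add_comm i, sub_eq_add_neg]

/-- The Hamiltonian vector field of `∫ g` is `∑_k {·, Λ_q^k g}`. -/
theorem hasFinsum_hamField (f g : Density) :
    HasFinsum (fun k => pb α β f (shift k g)) (hamField (pencil α β) (integral g) f) := by
  induction f using MvPolynomial.induction_on with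
  | C a =>
    rw [show hamField (pencil α β) (integral g) (MvPolynomial.C a) = 0 from
      Derivation.map_algebraMap _ a]
    simpa [pb_C] using HasFinsum.zero
  | add f f' h h' => simpa [pb_add] using h.add h'
  | mul_X f i h =>
    have hX : HasFinsum (fun k => pb α β (MvPolynomial.X i) (shift k g))
        (hamField (pencil α β) (integral g) (MvPolynomial.X i)) := by
      rw [hamField, MvPolynomial.mkDerivation_X]
      rcases i with i | i | i
      · exact hasFinsum_pb_u i g
      · exact hasFinsum_pb_v i g
      · change HasFinsum (fun k => pb α β (ev i) (shift k g)) _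
        simp only [pb_ev, Derivation.smul_apply, smul_eq_mul]
        exact (hasFinsum_pb_v i g).mul_left _
    simpa [pb_mul] using (hX.mul_left f).add (h.mul_left (MvPolynomial.X i))

theorem hamField_shift (P : OpMatrix) (G : Functional) (n : ℤ) (f : Density) :
    hamField P G (shift n f) = shift n (hamField P G f) := by
  induction f using MvPolynomial.induction_on with
  | C a =>
    have h : hamField P G (MvPolynomial.C a) = 0 := Derivation.map_algebraMap _ a
    rw [shift_C, h, map_zero]
  | add f g hf hg => simp [hf, hg]
  | mul_X f i hf =>
    have hX : hamField P G (shift n (MvPolynomial.X i)) =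
        shift n (hamField P G (MvPolynomial.X i)) := by
      rw [shift_X, hamField, MvPolynomial.mkDerivation_X, MvPolynomial.mkDerivation_X]
      cases i <;> simp [Jet.shift, shift_shift, add_comm n]
    rw [map_mul, Derivation.leibniz, Derivation.leibniz, hf, hX]
    simp

theorem integral_shift (n : ℤ) (f : Density) : integral (shift n f) = integral f := by
  have h1 (f : Density) : integral (shift 1 f) = integral f := by
    rw [← sub_eq_zero, ← map_sub]
    exact (Submodule.Quotient.mk_eq_zero _).2 ⟨f, rfl⟩
  induction n using Int.induction_on with
  | zero => rw [shift_zero]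
  | succ n ih => rw [add_comm, ← shift_shift, h1, ih]
  | pred n ih =>
    rw [← h1, shift_shift, show (1 : ℤ) + (-n - 1) = -n by ring, ih]

/-! ### Summation by parts. -/

/-- The pairing of a family with the shifts of a density. -/
def pairing (X : Density) : (ℤ →₀ Density) →ₗ[Density] Density :=
  Finsupp.linearCombination Density fun k => shift k X

theorem integral_pairing (X : Density) (m : ℤ →₀ Density) :
    integral (pairing X m) = integral (pullBack m * X) := by
  induction m using Finsupp.induction_linear with
  | zero => simp
  | add f g hf hg => simp [add_mul, hf, hg]
  | single k b =>
    rw [pullBack_single, ← integral_shift k (_ * X)]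
    simp [pairing, shift_shift, shift_zero]

theorem hamField_eq_pairing (P : OpMatrix) (G : Functional) (f : Density) :
    hamField P G f = pairing (fieldBracket P .u G) (grad .u f) +
      pairing (fieldBracket P .v G) (grad .v f) := by
  have h : hamField P G = (pairing (fieldBracket P .u G)).compDer (grad .u) +
      (pairing (fieldBracket P .v G)).compDer (grad .v) :=
    MvPolynomial.derivation_ext fun i => by
      cases i <;> simp [hamField, grad, pairing, MvPolynomial.mkDerivation_X]
  rw [h]
  rfl

theorem bracket_apply (P : OpMatrix) (F G : Functional) : bracket P F G = integral
    (varDeriv .u F * fieldBracket P .u G + varDeriv .v F * fieldBracket P .v G) := rfl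

/-- A functional evolves along a Hamiltonian vector field by the bracket with the Hamiltonian. -/
theorem integral_hamField (P : OpMatrix) (G : Functional) (f : Density) :
    integral (hamField P G f) = bracket P (integral f) G := by
  rw [hamField_eq_pairing, map_add, integral_pairing, integral_pairing, ← map_add]
  rfl

/-! ### Poisson property of the pencil -/

/-- Under the integral `{f, Λ^k g}` equals `{Λ^{-k} f, g}`; the swap then replaces `k` by `-k` in
the sum. -/
theorem bracket_pencil_skew (F G : Functional) :
    bracket (pencil α β) F G = -bracket (pencil α β) G F := by
  obtain ⟨f, rfl⟩ := Submodule.mkQ_surjective _ F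
  obtain ⟨g, rfl⟩ := Submodule.mkQ_surjective _ G
  change bracket _ (integral f) (integral g) = -bracket _ (integral g) (integral f)
  rw [← integral_hamField, ← integral_hamField]
  refine ((hasFinsum_hamField f g).map integral).unique ?_
  have h := (((hasFinsum_hamField (α := α) (β := β) g f).map
    integral).reindex (Equiv.neg ℤ)).neg
  convert h using 2 with k
  simp only [Equiv.neg_apply]
  rw [← integral_shift k (pb α β g _), ← pb_shift, shift_shift, add_neg_cancel, shift_zero, pb_swap, map_neg]

/-- Hamiltonian vector fields form an (anti)representation of the bracket. -/
theorem hamField_hamField (f g h : Density) :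
    hamField (pencil α β) (integral (hamField (pencil α β) (integral h) g)) f =
      hamField (pencil α β) (integral h) (hamField (pencil α β) (integral g) f) -
        hamField (pencil α β) (integral g) (hamField (pencil α β) (integral h) f) := by
  have sum₁ (g h : Density) :
      HasFinsum (fun p : ℤ × ℤ => pb α β (pb α β f (shift p.1 g)) (shift p.2 h))
        (hamField (pencil α β) (integral h) (hamField (pencil α β) (integral g) f)) := by
    have hf := hasFinsum_hamField (α := α) (β := β) f g
    refine HasFinsum.prod
      (F₁ := fun k => hamField (pencil α β) (integral h) (pb α β f (shift k g)))
      hf.1 (fun k hk l => ?_) (fun k => hasFinsum_hamField (pb α β f (shift k g)) h)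
      (hf.map (hamField (pencil α β) (integral h)))
    rw [Function.notMem_support.1 hk, pb_zero, Derivation.zero_apply]
  have sum₂ :
      HasFinsum (fun p : ℤ × ℤ => pb α β f (shift p.2 (pb α β g (shift p.1 h))))
        (hamField (pencil α β) (integral (hamField (pencil α β) (integral h) g)) f) := by
    -- Additivity of `x ↦ X_{∫x} f` is needed to sum over the rows; it follows from uniqueness of
    -- finite sums.
    let φ : Density →+ Density :=
      { toFun := fun x => hamField (pencil α β) (integral x) f
        map_zero' := (hasFinsum_hamField f 0).unique (by simpa using HasFinsum.zero)
        map_add' := fun x y => by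
          refine (hasFinsum_hamField f (x + y)).unique ?_
          simpa using (hasFinsum_hamField f x).add (hasFinsum_hamField f y) }
    have hg := hasFinsum_hamField (α := α) (β := β) g h
    refine HasFinsum.prod
      (F₁ := fun k => hamField (pencil α β) (integral (pb α β g (shift k h))) f)
      hg.1 (fun k hk l => ?_) (fun k => hasFinsum_hamField f (pb α β g (shift k h))) (hg.map φ)
    rw [Function.notMem_support.1 hk, map_zero, map_zero]
  -- With this reindexing `{f, Λ^k {g, Λ^{l-k} h}}` becomes `{f, {Λ^k g, Λ^l h}}`, and the claim is
  -- the Jacobi identity term by term.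
  let e : ℤ × ℤ ≃ ℤ × ℤ :=
    { toFun := fun p => (p.2 - p.1, p.1)
      invFun := fun p => (p.2, p.1 + p.2)
      left_inv := fun p => by simp
      right_inv := fun p => by simp }
  refine (sum₂.reindex e).unique ?_
  convert (sum₁ g h).sub ((sum₁ h g).reindex (Equiv.prodComm ℤ ℤ)) using 2 with p
  obtain ⟨k, l⟩ := p
  have hj := jac_eq_zero (α := α) (β := β) f (shift k g) (shift l h)
  simp only [e, Equiv.coe_fn_mk, Equiv.prodComm_apply, Prod.swap_prod_mk, ← pb_shift, shift_shift,
    add_sub_cancel]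
  rw [jac, pb_swap (shift l h) f, pb_swap (shift l h) (pb α β f _), map_neg,
    pb_swap (shift k g) (pb α β f _)] at hj
  linear_combination hj

theorem isPoisson_pencil (α β : ℂ) : IsPoisson (bracket (pencil α β)) where
  skew := bracket_pencil_skew
  jacobi F G H := by
    have hskew (X Y) := bracket_pencil_skew (α := α) (β := β) X Y
    -- Skew-symmetry brings every term to an action of vector fields on `f`, where
    -- `hamField_hamField` cancels them.
    rw [hskew H F, map_neg, hskew G (bracket _ F H), hskew H (bracket _ F G)]
    obtain ⟨f, rfl⟩ := Submodule.mkQ_surjective _ F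
    obtain ⟨g, rfl⟩ := Submodule.mkQ_surjective _ G
    obtain ⟨h, rfl⟩ := Submodule.mkQ_surjective _ H
    change bracket _ (integral f) (bracket _ (integral g) (integral h)) +
      - -bracket _ (bracket _ (integral f) (integral h)) (integral g) +
      -bracket _ (bracket _ (integral f) (integral g)) (integral h) = 0
    simp only [← integral_hamField, hamField_hamField, map_sub]
    abel

theorem isPoisson_combination (ε c c' : ℂ) :
    IsPoisson (c • bracket (P₁ ε) + c' • bracket (P₂ ε)) := by
  have h : c • bracket (P₁ ε) + c' • bracket (P₂ ε) =
      bracket (pencil (c * ε⁻¹) (c' * ε⁻¹)) := by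
    refine LinearMap.ext₂ fun F G => ?_
    simp only [LinearMap.add_apply, LinearMap.smul_apply, bracket_apply, ← map_smul, ← map_add]
    congr 1
    simp [fieldBracket, P₁, P₂, pencil, Lam, mulOp, aff, MvPolynomial.smul_eq_C_mul]
    ring
  rw [h]
  exact isPoisson_pencil _ _

end QToda

end

noncomputable section

/-! ### The Lax equation in components. -/

namespace DiffOp

theorem lax_eq_iff {R : Type*} [CommRing R] [MulSemiringAction (Multiplicative ℤ) R] [Algebra ℂ R]
    [SMulCommClass (Multiplicative ℤ) ℂ R] (c : ℂ) (p r a b : R) (j : ℕ) :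
    c • (mono 0 p + mono (-1) r) = ⁅plus (B a b j), lax a b⁆ ↔
      c • p = act 1 (cf (B a b j) (-1)) - cf (B a b j) (-1) ∧
      c • r = b * (cf (B a b j) 0 - act (-1) (cf (B a b j) 0)) := by
  rw [lie_plus_lax (commute_B a b j)]
  constructor
  · intro h
    constructor
    · simpa [cf_mono] using congrArg (fun A => cf A 0) h
    · simpa [cf_mono] using congrArg (fun A => cf A (-1)) h
  · rintro ⟨h0, h1⟩
    refine ext_cf fun k => ?_
    simp only [cf_smul, cf_add, smul_add, cf_mono, smul_ite, smul_zero, h0, h1]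

end DiffOp

namespace QToda

open DiffOp

instance : SMulCommClass (Multiplicative ℤ) ℂ Density :=
  ⟨fun n c f => map_smul (shift n.toAdd) c f⟩

instance (ε : ℂ) : SMulCommClass (Multiplicative ℤ) ℂ (QFun ε) := ⟨fun _ _ _ => rfl⟩

/-! ### Hamiltonian equations of the hierarchy -/

theorem fieldBracket_P₁_u_H (ε : ℂ) (n : ℕ) :
    fieldBracket (P₁ ε) .u (H n) = ε⁻¹ • (shift 1 (lcf n (-1)) - lcf n (-1)) := by
  rw [← shift_varDeriv_v_H]
  simp [fieldBracket, P₁, Lam]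

theorem fieldBracket_P₁_v_H (ε : ℂ) (n : ℕ) :
    fieldBracket (P₁ ε) .v (H n) = ε⁻¹ • (lcf n 0 - shift (-1) (lcf n 0)) := by
  simp [fieldBracket, P₁, Lam, varDeriv_u_H]

theorem hamField_uu (P : OpMatrix) (G : Functional) (k : ℤ) :
    hamField P G (uu k) = shift k (fieldBracket P .u G) := MvPolynomial.mkDerivation_X _ _ _

theorem hamField_vv (P : OpMatrix) (G : Functional) (k : ℤ) :
    hamField P G (vv k) = shift k (fieldBracket P .v G) := MvPolynomial.mkDerivation_X _ _ _

theorem hamField_ev (P : OpMatrix) (G : Functional) (k : ℤ) :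
    hamField P G (ev k) = ev k * shift k (fieldBracket P .v G) := MvPolynomial.mkDerivation_X _ _ _

theorem cf_B_density (j : ℕ) (k : ℤ) : cf (B (uu 0) (ev 0) j) k = lcf (j + 1) k := cf_B _ _ _ _

theorem isFlow_hamField {ε : ℂ} (hε : ε ≠ 0) (j : ℕ) :
    IsFlow ε j (hamField (P₁ ε) (H (j + 1))) where
  comm_shift := hamField_shift _ _ 1
  chain_rule := by rw [hamField_ev, hamField_vv]
  lax_eq := by
    rw [lax_eq_iff, hamField_uu, hamField_ev, shift_zero, shift_zero, fieldBracket_P₁_u_H,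
      fieldBracket_P₁_v_H, mul_smul_comm, smul_inv_smul₀ hε, smul_inv_smul₀ hε, cf_B_density,
      cf_B_density]
    exact ⟨rfl, rfl⟩

theorem derivation_comm_shift {D : Derivation ℂ Density Density}
    (h : ∀ f, D (shift 1 f) = shift 1 (D f)) (n : ℤ) (f : Density) :
    D (shift n f) = shift n (D f) := by
  induction n using Int.induction_on generalizing f with
  | zero => simp only [shift_zero]
  | succ n ih => rw [add_comm, ← shift_shift, h, ih, shift_shift]
  | pred n ih =>
    have h1 : D f = shift 1 (D (shift (-1) f)) := by
      rw [← h, shift_shift, add_neg_cancel, shift_zero]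
    rw [sub_eq_add_neg, ← shift_shift, ih, ← shift_shift, h1, shift_shift (-1) 1, neg_add_cancel,
      shift_zero]

/-- An evolutionary derivation is determined by its values on `u` and `v`. -/
theorem IsFlow.eq_of_fields {ε : ℂ} {j : ℕ} {D D' : Derivation ℂ Density Density}
    (h : IsFlow ε j D) (h' : IsFlow ε j D') (hu : D (uu 0) = D' (uu 0))
    (hv : D (vv 0) = D' (vv 0)) : D = D' := by
  have key {f g : Density} {k : ℤ} (hf : D f = D' f) (hg : shift k f = g) : D g = D' g := by
    rw [← hg, derivation_comm_shift h.comm_shift, derivation_comm_shift h'.comm_shift, hf]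
  refine MvPolynomial.derivation_ext fun i => ?_
  rcases i with k | k | k
  · exact key hu (by rw [shift_uu, zero_add]; rfl)
  · exact key hv (by rw [shift_vv, zero_add]; rfl)
  · exact key (f := ev 0) (by rw [h.chain_rule, h'.chain_rule, hv])
      (by rw [shift_ev, zero_add]; rfl)

/-- The Lax equation fixes `D u` and `e^v D v`; densities form a domain, so `e^v` cancels. -/
theorem IsFlow.unique {ε : ℂ} (hε : ε ≠ 0) {j : ℕ} {D D' : Derivation ℂ Density Density}
    (h : IsFlow ε j D) (h' : IsFlow ε j D') : D = D' := by
  obtain ⟨hu, hv⟩ := (lax_eq_iff _ _ _ _ _ _).1 h.lax_eq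
  obtain ⟨hu', hv'⟩ := (lax_eq_iff _ _ _ _ _ _).1 h'.lax_eq
  refine h.eq_of_fields h' (smul_right_injective _ hε (hu.trans hu'.symm)) ?_
  have he : ev 0 * D (vv 0) = ev 0 * D' (vv 0) := by
    rw [← h.chain_rule, ← h'.chain_rule]
    exact smul_right_injective _ hε (hv.trans hv'.symm)
  exact mul_left_cancel₀ (MvPolynomial.X_ne_zero _) he

theorem isFlow_iff {ε : ℂ} (hε : ε ≠ 0) (j : ℕ) (D : Derivation ℂ Density Density) :
    IsFlow ε j D ↔ D = hamField (P₁ ε) (H (j + 1)) := by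
  constructor
  · exact fun h => h.unique hε (isFlow_hamField hε j)
  · rintro rfl
    exact isFlow_hamField hε j

/-! ### The bi-Hamiltonian recursion -/

theorem hamField_congr {P P' : OpMatrix} {G G' : Functional} {c : ℂ}
    (h : ∀ w, fieldBracket P w G = c • fieldBracket P' w G') :
    hamField P G = c • hamField P' G' :=
  MvPolynomial.derivation_ext fun i => by
    rw [Derivation.smul_apply]
    rcases i with k | k | k
    · exact (hamField_uu P G k).trans (by rw [h, map_smul, ← hamField_uu]; rfl)
    · exact (hamField_vv P G k).trans (by rw [h, map_smul, ← hamField_vv]; rfl)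
    · exact (hamField_ev P G k).trans (by
        rw [h, map_smul, mul_smul_comm, ← hamField_ev]; rfl)

theorem bracket_congr {P P' : OpMatrix} {G G' : Functional} {c : ℂ}
    (h : ∀ w, fieldBracket P w G = c • fieldBracket P' w G') (F : Functional) :
    bracket P F G = c • bracket P' F G' := by
  rw [bracket_apply, bracket_apply, ← map_smul, h, h, smul_add, mul_smul_comm, mul_smul_comm]

theorem fieldBracket_recursion (ε : ℂ) (m : ℕ) (w : Fld) : fieldBracket (P₂ ε) w (H m) =
    ((m + 1 : ℕ) : ℂ) • fieldBracket (P₁ ε) w (H (m + 1)) := by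
  have hδ := shift_varDeriv_v_H m
  cases w
  · have h1 := succ_smul_lcf m (-1)
    have h2 := lcf_commute m (-1)
    norm_num at h1 h2
    have h3 : fieldBracket (P₂ ε) .u (H m) = ε⁻¹ • (shift 1 (ev 0 * lcf m 0) -
        ev 0 * shift (-1) (lcf m 0) + uu 0 * (shift 1 (lcf m (-1)) - lcf m (-1))) := by
      rw [← hδ]
      simp [fieldBracket, P₂, Lam, mulOp, varDeriv_u_H]
    rw [h3, fieldBracket_P₁_u_H, smul_comm, smul_sub, ← map_smul]
    push_cast
    rw [h1]
    congr 1
    simp only [map_add, map_mul, shift_ev, shift_uu]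
    norm_num
    -- The shifted part of `(Λ - 1)` was expanded through `L^m L`; `h2` rewrites the unshifted part
    -- through `L L^m`.
    linear_combination h2
  · have h1 := succ_smul_lcf m 0
    have h2 := lcf_commute m 0
    have hδ' := congrArg (shift (-1)) hδ
    simp only [map_sub, shift_shift, neg_add_cancel, shift_zero] at hδ'
    norm_num at h1 h2
    have h3 : fieldBracket (P₂ ε) .v (H m) = ε⁻¹ • (uu 0 * lcf m 0 - shift (-1) (uu 0 * lcf m 0) +
        (shift 1 (varDeriv .v (H m)) - shift (-1) (varDeriv .v (H m)))) := by
      simp [fieldBracket, P₂, Lam, mulOp, varDeriv_u_H]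
    have h4 : shift 1 (varDeriv .v (H m)) = lcf m 1 * ev 1 := by
      rw [varDeriv_v_H]
      simp [shift_shift, shift_zero, mul_comm]
    have h5 : shift (-1) (lcf m 1 * ev 1) = varDeriv .v (H m) := by
      rw [← h4, shift_shift, neg_add_cancel, shift_zero]
    rw [h3, fieldBracket_P₁_v_H, smul_comm, smul_sub, ← map_smul]
    push_cast
    rw [h1]
    congr 1
    rw [map_add, map_add, h5, h4, mul_comm (uu 0)]
    -- What remains is `(1 - Λ^{-1}) ℓ_{-1} = (1 - Λ^{-1}) δH_m/δv`, which completes `Λ - 1` to `Λ -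
    -- Λ^{-1}`.
    linear_combination hδ'

/-- `L^0 = 1` has only the constant coefficient `1`, and differences kill it. -/
theorem hamField_P₁_H_zero (ε : ℂ) : hamField (P₁ ε) (H 0) = 0 := by
  have h : hamField (P₁ ε) (H 0) = (0 : ℂ) • hamField (P₁ ε) (H 0) := by
    refine hamField_congr fun w => ?_
    rw [zero_smul]
    cases w
    · simp [fieldBracket_P₁_u_H, lcf, cf_one]
    · simp [fieldBracket_P₁_v_H, lcf, cf_one]
  rw [h, zero_smul]

/-! ### Solutions by functions -/

theorem evalAt_shift (ε : ℂ) (u v : ℂ → ℂ) (x : ℂ) (n : ℤ) (f : Density) :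
    evalAt ε u v x (shift n f) = evalAt ε u v (Complex.exp ε ^ n * x) f := by
  have h (k : ℤ) : Complex.exp ε ^ (k + n) * x = Complex.exp ε ^ k * (Complex.exp ε ^ n * x) := by
    rw [zpow_add₀ (Complex.exp_ne_zero ε), mul_assoc]
  rw [evalAt, evalAt, shift, MvPolynomial.aeval_rename]
  congr 2
  funext i
  cases i <;> simp [Jet.shift, h]

theorem evalAt_uu (ε : ℂ) (u v : ℂ → ℂ) (x : ℂ) (k : ℤ) :
    evalAt ε u v x (uu k) = u (Complex.exp ε ^ k * x) := MvPolynomial.aeval_X _ _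

theorem evalAt_ev (ε : ℂ) (u v : ℂ → ℂ) (x : ℂ) (k : ℤ) :
    evalAt ε u v x (ev k) = Complex.exp (v (Complex.exp ε ^ k * x)) := MvPolynomial.aeval_X _ _

theorem QFun.eq_iff {ε : ℂ} {f g : QFun ε} : f = g ↔ ∀ x, f x = g x :=
  funext_iff (β := fun _ : ℂ => ℂ)

/-- A function of `x`, as an element of the ring with the action of `Λ_q`. -/
def toQFun (ε : ℂ) (u : ℂ → ℂ) : QFun ε := u

/-- The function `e^v`. -/
def expFun (ε : ℂ) (v : ℂ → ℂ) : QFun ε := fun x => Complex.exp (v x)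

/-- Evaluation is multiplicative and turns jets into shifted values, so both sides obey the
recursion `L^{n+1} = L^n L`. -/
theorem cf_pow_eval (ε : ℂ) (u v : ℂ → ℂ) (n : ℕ) (k : ℤ) (x : ℂ) :
    cf (lax (toQFun ε u) (expFun ε v) ^ n) k x =
      evalAt ε u v x (cf (lax (uu 0) (ev 0) ^ n) k) := by
  induction n generalizing k with
  | zero =>
    rw [pow_zero, pow_zero, cf_one, cf_one]
    split_ifs
    · exact (map_one _).symm
    · exact (map_zero _).symm
  | succ n ih =>
    rw [pow_succ, pow_succ, cf_mul_lax, cf_mul_lax, act_eq_shift, act_eq_shift, shift_uu,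
      shift_ev, zero_add, zero_add, map_add, map_add, map_mul, map_mul, evalAt_uu, evalAt_ev,
      ← ih, ← ih, ← ih]
    rfl

theorem cf_B_eval (ε : ℂ) (u v : ℂ → ℂ) (j : ℕ) (k : ℤ) (x : ℂ) :
    cf (B (toQFun ε u) (expFun ε v) j) k x = evalAt ε u v x (lcf (j + 1) k) := by
  rw [lcf, map_smul, ← cf_pow_eval, cf_B]
  rfl

theorem lax_eq_iff_eval (ε : ℂ) (u v du dv : ℂ → ℂ) (j : ℕ) :
    ε • (mono 0 (toQFun ε du) + mono (-1) (toQFun ε fun x => Complex.exp (v x) * dv x)) =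
        ⁅plus (B (toQFun ε u) (expFun ε v) j), lax (toQFun ε u) (expFun ε v)⁆ ↔
      ∀ x, ε * du x = evalAt ε u v x (shift 1 (lcf (j + 1) (-1)) - lcf (j + 1) (-1)) ∧
        ε * dv x = evalAt ε u v x (lcf (j + 1) 0 - shift (-1) (lcf (j + 1) 0)) := by
  rw [lax_eq_iff, QFun.eq_iff, QFun.eq_iff, ← forall_and]
  refine forall_congr' fun x => and_congr ?_ ?_
  · rw [map_sub, evalAt_shift, ← cf_B_eval, ← cf_B_eval]
    exact Iff.rfl
  · rw [map_sub, evalAt_shift, ← cf_B_eval, ← cf_B_eval]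
    change ε * (Complex.exp (v x) * dv x) = Complex.exp (v x) * _ ↔ _
    rw [mul_left_comm, mul_right_inj' (Complex.exp_ne_zero _)]
    exact Iff.rfl

theorem solvesLax_iff {ε : ℂ} (hε : ε ≠ 0) (j : ℕ) (U V : ℂ → ℂ → ℂ) (t : ℂ) :
    SolvesLax ε j U V t ↔ SolvesHamilton ε (P₁ ε) (H (j + 1)) U V t := by
  have hs (a b : ℂ) : ε * a = b ↔ a = ε⁻¹ • b := by
    rw [smul_eq_mul, eq_inv_mul_iff_mul_eq₀ hε]
  simp only [SolvesHamilton, fieldBracket_P₁_u_H, fieldBracket_P₁_v_H, map_smul]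
  constructor
  · rintro ⟨du, dv, hu, hv, h⟩ x
    have hx := (lax_eq_iff_eval ε (U t) (V t) du dv j).1 h x
    rw [hs, hs] at hx
    rw [← hx.1, ← hx.2]
    exact ⟨hu x, hv x⟩
  · intro h
    -- The witnesses for `∂u/∂t` and `∂v/∂t` are the Hamiltonian right-hand sides.
    refine ⟨_, _, fun x => (h x).1, fun x => (h x).2, ?_⟩
    refine (lax_eq_iff_eval ε (U t) (V t) _ _ j).2 fun x => ?_
    rw [hs, hs]
    exact ⟨rfl, rfl⟩

end QToda

end

theorem mainTheorem4 (ε : ℂ) (hε : ε ≠ 0) :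
    -- two compatible Poisson brackets
    (QToda.IsPoisson (QToda.bracket (QToda.P₁ ε)) ∧
      QToda.IsPoisson (QToda.bracket (QToda.P₂ ε)) ∧
      QToda.Compatible (QToda.bracket (QToda.P₁ ε)) (QToda.bracket (QToda.P₂ ε))) ∧
    -- the flow `∂/∂t_j` exists, is unique, and is the Hamiltonian vector field of `H_{j+1}`
    (∀ (j : ℕ) (D : Derivation ℂ QToda.Density QToda.Density),
      QToda.IsFlow ε j D ↔ D = QToda.hamField (QToda.P₁ ε) (QToda.H (j + 1))) ∧
    -- functionals evolve by `∂F/∂t_j = {F, H_{j+1}}₁`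
    (∀ (j : ℕ) (D : Derivation ℂ QToda.Density QToda.Density), QToda.IsFlow ε j D →
      ∀ f : QToda.Density, QToda.integral (D f) =
        QToda.bracket (QToda.P₁ ε) (QToda.integral f) (QToda.H (j + 1))) ∧
    -- for functions, the Lax equation is the Hamiltonian system
    (∀ (j : ℕ) (U V : ℂ → ℂ → ℂ) (t : ℂ),
      QToda.SolvesLax ε j U V t ↔
        QToda.SolvesHamilton ε (QToda.P₁ ε) (QToda.H (j + 1)) U V t) ∧
    -- `H_0` is a Casimir of the first bracket
    QToda.hamField (QToda.P₁ ε) (QToda.H 0) = 0 ∧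
    -- the bi-Hamiltonian recursion, on densities and on functionals
    (∀ n : ℕ, 1 ≤ n →
      QToda.hamField (QToda.P₂ ε) (QToda.H (n - 1)) =
        (n : ℂ) • QToda.hamField (QToda.P₁ ε) (QToda.H n)) ∧
    (∀ n : ℕ, 1 ≤ n → ∀ F : QToda.Functional,
      QToda.bracket (QToda.P₂ ε) F (QToda.H (n - 1)) =
        (n : ℂ) • QToda.bracket (QToda.P₁ ε) F (QToda.H n)) := by
  have poisson := QToda.isPoisson_combination ε
  refine ⟨⟨by simpa using poisson 1 0, by simpa using poisson 0 1, poisson⟩, QToda.isFlow_iff hε,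
    fun j D hD f => ?_, QToda.solvesLax_iff hε, QToda.hamField_P₁_H_zero ε, fun n hn => ?_,
    fun n hn F => ?_⟩
  · rw [(QToda.isFlow_iff hε j D).1 hD, QToda.integral_hamField]
  · obtain ⟨m, rfl⟩ := Nat.exists_eq_add_of_le' hn
    exact QToda.hamField_congr (QToda.fieldBracket_recursion ε m)
  · obtain ⟨m, rfl⟩ := Nat.exists_eq_add_of_le' hn
    exact QToda.bracket_congr (QToda.fieldBracket_recursion ε m) F
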